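/- Let $M$ be a connected smooth (Hausdorff) manifold without boundary, of dimension $n>1$, and let $\mu$ be a volume form on $M$, i.e. a smooth nowhere vanishing $n$-form. Let $\mathfrak X(M)$ be the Lie algebra of smooth vector fields on $M$, and let $$\mathfrak X(M,[\mu]) := \{X\in\mathfrak X(M) : \text{there is a constant } \lambda\in\mathbb R \text{ with } L_X\mu=\lambda\mu\}.$$ Then there does not exist a Lie subalgebra $\mathfrak g\subseteq\mathfrak X(M)$ such that $\mathfrak X(M,[\mu])\subsetneq\mathfrak g$ and $\mathfrak X(M,[\mu])$ has finite codimension in $\mathfrak g$, i.e. $\dim_{\mathbb R}\bigl(\mathfrak g/\mathfrak X(M,[\mu])\bigr)<\infty$. -/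

import Mathlib

open scoped Manifold ContDiff

/-! ### The Lie algebra of smooth vector fields -/

/-- Smooth vector fields on a smooth `n`-dimensional manifold `M` (without boundary), as smooth
sections of the tangent bundle. -/
abbrev SmoothVectorField (n : ℕ) (M : Type*) [TopologicalSpace M]
    [ChartedSpace (EuclideanSpace ℝ (Fin n)) M] [IsManifold (𝓡 n) ∞ M] : Type _ :=
  ContMDiffSection (𝓡 n) (EuclideanSpace ℝ (Fin n)) ∞ (fun x : M => TangentSpace (𝓡 n) x)

namespace SmoothVectorField

variable {n : ℕ} {M : Type*} [TopologicalSpace M]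
  [ChartedSpace (EuclideanSpace ℝ (Fin n)) M] [IsManifold (𝓡 n) ∞ M]

theorem natCast_le_infty (k : ℕ) : (k : WithTop ℕ∞) ≤ ∞ := by
  exact_mod_cast (le_top : (k : ℕ∞) ≤ ⊤)

variable (n M) in
theorem isManifold_of_infty (k : ℕ) : IsManifold (𝓡 n) (k : WithTop ℕ∞) M :=
  IsManifold.of_le (n := ∞) (natCast_le_infty k)

theorem contMDiff_mlieBracket (X Y : SmoothVectorField n M) :
    ContMDiff (𝓡 n) ((𝓡 n).prod 𝓘(ℝ, EuclideanSpace ℝ (Fin n))) ∞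
      (fun x => (⟨x, VectorField.mlieBracket (𝓡 n) X Y x⟩ : TangentBundle (𝓡 n) M)) := by
  have : IsManifold (𝓡 n) (((⊤ : ℕ∞) : WithTop ℕ∞) + 1) M := by
    change IsManifold (𝓡 n) ∞ M
    infer_instance
  have : IsManifold (𝓡 n) (minSmoothness ℝ 2) M := by
    simpa using isManifold_of_infty n M 2
  exact ContDiff.mlieBracket_vectorField (m := ⊤) (n := ⊤) X.contMDiff Y.contMDiff (by simp)

/-- The usual Lie bracket of vector fields. -/
noncomputable instance instBracket : Bracket (SmoothVectorField n M) (SmoothVectorField n M) where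
  bracket X Y := ⟨fun x => VectorField.mlieBracket (𝓡 n) X Y x, contMDiff_mlieBracket X Y⟩

theorem bracket_apply (X Y : SmoothVectorField n M) (x : M) :
    ⁅X, Y⁆ x = VectorField.mlieBracket (𝓡 n) X Y x := rfl

theorem coe_bracket (X Y : SmoothVectorField n M) :
    ⇑⁅X, Y⁆ = VectorField.mlieBracket (𝓡 n) X Y := rfl

theorem mdiffAt (X : SmoothVectorField n M) (x : M) :
    MDifferentiableAt (𝓡 n) ((𝓡 n).prod 𝓘(ℝ, EuclideanSpace ℝ (Fin n)))
      (fun y => (⟨y, X y⟩ : TangentBundle (𝓡 n) M)) x :=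
  X.contMDiff.contMDiffAt.mdifferentiableAt (by simp)

noncomputable instance instLieRing : LieRing (SmoothVectorField n M) where
  add_lie X Y Z := by
    have := isManifold_of_infty n M 2
    ext1 x
    rw [ContMDiffSection.coe_add, Pi.add_apply, bracket_apply, bracket_apply, bracket_apply,
      ContMDiffSection.coe_add]
    exact VectorField.mlieBracket_add_left (X.mdiffAt x) (Y.mdiffAt x)
  lie_add X Y Z := by
    have := isManifold_of_infty n M 2
    ext1 x
    rw [ContMDiffSection.coe_add, Pi.add_apply, bracket_apply, bracket_apply, bracket_apply,
      ContMDiffSection.coe_add]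
    exact VectorField.mlieBracket_add_right (Y.mdiffAt x) (Z.mdiffAt x)
  lie_self X := by
    ext1 x
    rw [bracket_apply, VectorField.mlieBracket_self]
    rfl
  leibniz_lie X Y Z := by
    have : IsManifold (𝓡 n) (minSmoothness ℝ 3) M := by
      simpa using isManifold_of_infty n M 3
    have h : ∀ W : SmoothVectorField n M, ContMDiff (𝓡 n)
        ((𝓡 n).prod 𝓘(ℝ, EuclideanSpace ℝ (Fin n))) (minSmoothness ℝ 2)
        (fun x => (⟨x, W x⟩ : TangentBundle (𝓡 n) M)) := fun W =>
      W.contMDiff.of_le (by simpa using natCast_le_infty 2)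
    ext1 x
    rw [ContMDiffSection.coe_add, Pi.add_apply, bracket_apply, bracket_apply, bracket_apply,
      coe_bracket, coe_bracket, coe_bracket]
    exact VectorField.leibniz_identity_mlieBracket_apply (h X x) (h Y x) (h Z x)

noncomputable instance instLieAlgebra : LieAlgebra ℝ (SmoothVectorField n M) where
  lie_smul c X Y := by
    have := isManifold_of_infty n M 2
    ext1 x
    rw [ContMDiffSection.coe_smul, Pi.smul_apply, bracket_apply, bracket_apply,
      ContMDiffSection.coe_smul]
    exact VectorField.mlieBracket_const_smul_right (Y.mdiffAt x)

end SmoothVectorField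

/-! ### Lie derivatives of differential forms -/

section ModelSpace

variable {E : Type*} [NormedAddCommGroup E] [NormedSpace ℝ E] {k : ℕ}

/-- The Lie derivative `L_X η` of a `k`-form `η` along a vector field `X` on a normed space; see
`flatLieDeriv_apply` for the formula. -/
noncomputable def flatLieDeriv (X : E → E) (η : E → E [⋀^Fin k]→L[ℝ] ℝ) (y : E) :
    E [⋀^Fin k]→L[ℝ] ℝ :=
  fderiv ℝ η y (X y) +
    (η y).fderivCompContinuousLinearMap (ContinuousLinearMap.id ℝ E) (fderiv ℝ X y)

/-- `(L_X η)(v₁, …, v_k) = (D_X η)(v₁, …, v_k) + ∑ᵢ η(v₁, …, DX(vᵢ), …, v_k)`. -/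
theorem flatLieDeriv_apply (X : E → E) (η : E → E [⋀^Fin k]→L[ℝ] ℝ) (y : E) (v : Fin k → E) :
    flatLieDeriv X η y v = fderiv ℝ η y (X y) v +
      ∑ i, η y (Function.update v i (fderiv ℝ X y (v i))) := by
  simp only [flatLieDeriv, ContinuousAlternatingMap.add_apply,
    ContinuousAlternatingMap.fderivCompContinuousLinearMap_apply]
  congr 1
  refine Finset.sum_congr rfl fun i _ => congrArg (η y) (funext fun j => ?_)
  by_cases h : j = i
  · subst h
    simp
  · simp [Function.update_of_ne h]

theorem flatLieDeriv_add {X Y : E → E} (η : E → E [⋀^Fin k]→L[ℝ] ℝ) {y : E}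
    (hX : DifferentiableAt ℝ X y) (hY : DifferentiableAt ℝ Y y) :
    flatLieDeriv (X + Y) η y = flatLieDeriv X η y + flatLieDeriv Y η y := by
  simp only [flatLieDeriv, fderiv_add hX hY, Pi.add_apply, map_add]
  abel

theorem flatLieDeriv_const_smul (c : ℝ) (X : E → E) (η : E → E [⋀^Fin k]→L[ℝ] ℝ) {y : E} :
    flatLieDeriv (c • X) η y = c • flatLieDeriv X η y := by
  simp only [flatLieDeriv, fderiv_const_smul_field, Pi.smul_apply, map_smul, smul_add]

end ModelSpace

section Manifold

variable {n : ℕ} {M : Type*} [TopologicalSpace M] [ChartedSpace (EuclideanSpace ℝ (Fin n)) M]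

/-- The coordinate expression, in the preferred chart at `x₀`, of a (not necessarily smooth)
`k`-form on `M`: its pullback along the inverse of the chart. -/
noncomputable def formInChart {k : ℕ} (η : ∀ x : M, TangentSpace (𝓡 n) x [⋀^Fin k]→L[ℝ] ℝ)
    (x₀ : M) (y : EuclideanSpace ℝ (Fin n)) : EuclideanSpace ℝ (Fin n) [⋀^Fin k]→L[ℝ] ℝ :=
  (η ((extChartAt (𝓡 n) x₀).symm y)).compContinuousLinearMap
    (mfderiv 𝓘(ℝ, EuclideanSpace ℝ (Fin n)) (𝓡 n) (extChartAt (𝓡 n) x₀).symm y)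

/-- The coordinate expression of a vector field in the preferred chart at `x₀`. -/
noncomputable def fieldInChart (X : ∀ x : M, TangentSpace (𝓡 n) x) (x₀ : M) :
    EuclideanSpace ℝ (Fin n) → EuclideanSpace ℝ (Fin n) :=
  VectorField.mpullback 𝓘(ℝ, EuclideanSpace ℝ (Fin n)) (𝓡 n) (extChartAt (𝓡 n) x₀).symm X

/-- The Lie derivative `L_X η` of a `k`-form `η` along a vector field `X` on `M`, computed at `x`
in the preferred chart at `x`. -/
noncomputable def lieDeriv {k : ℕ} (X : ∀ x : M, TangentSpace (𝓡 n) x)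
    (η : ∀ x : M, TangentSpace (𝓡 n) x [⋀^Fin k]→L[ℝ] ℝ) (x : M) :
    TangentSpace (𝓡 n) x [⋀^Fin k]→L[ℝ] ℝ :=
  ContinuousAlternatingMap.compContinuousLinearMap
    (flatLieDeriv (fieldInChart X x) (formInChart η x) (extChartAt (𝓡 n) x x))
    (mfderiv (𝓡 n) 𝓘(ℝ, EuclideanSpace ℝ (Fin n)) (extChartAt (𝓡 n) x) x)

end Manifold

/-- A volume form on an `n`-dimensional manifold: a smooth, nowhere vanishing `n`-form. -/
structure VolumeForm (n : ℕ) (M : Type*) [TopologicalSpace M]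
    [ChartedSpace (EuclideanSpace ℝ (Fin n)) M] where
  /-- The underlying `n`-form. -/
  form : ∀ x : M, TangentSpace (𝓡 n) x [⋀^Fin n]→L[ℝ] ℝ
  smooth : ∀ x₀ : M, ContDiffOn ℝ ∞ (formInChart form x₀) (extChartAt (𝓡 n) x₀).target
  ne_zero : ∀ x : M, form x ≠ 0

section Conformal

variable {n : ℕ} {M : Type*} [TopologicalSpace M]
  [ChartedSpace (EuclideanSpace ℝ (Fin n)) M] [IsManifold (𝓡 n) ∞ M]

theorem SmoothVectorField.differentiableAt_fieldInChart (X : SmoothVectorField n M) (x : M) :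
    DifferentiableAt ℝ (fieldInChart X x) (extChartAt (𝓡 n) x x) := by
  have := SmoothVectorField.isManifold_of_infty n M 2
  have h := (X.mdiffAt x).mdifferentiableWithinAt (s := Set.univ)
    |>.differentiableWithinAt_mpullbackWithin_vectorField
  have hr : Set.range (𝓡 n) = Set.univ := by simp
  rw [hr, Set.preimage_univ, Set.inter_univ, VectorField.mpullbackWithin_univ] at h
  exact h.differentiableAt Filter.univ_mem

theorem lieDeriv_add {k : ℕ} (X Y : SmoothVectorField n M)
    (η : ∀ x : M, TangentSpace (𝓡 n) x [⋀^Fin k]→L[ℝ] ℝ) (x : M) :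
    lieDeriv ⇑(X + Y) η x = lieDeriv ⇑X η x + lieDeriv ⇑Y η x := by
  have h : fieldInChart ⇑(X + Y) x = fieldInChart ⇑X x + fieldInChart ⇑Y x := by
    rw [ContMDiffSection.coe_add]
    exact VectorField.mpullback_add
  unfold lieDeriv
  rw [h, flatLieDeriv_add _ (X.differentiableAt_fieldInChart x)
    (Y.differentiableAt_fieldInChart x)]
  rfl

theorem lieDeriv_smul {k : ℕ} (c : ℝ) (X : SmoothVectorField n M)
    (η : ∀ x : M, TangentSpace (𝓡 n) x [⋀^Fin k]→L[ℝ] ℝ) (x : M) :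
    lieDeriv ⇑(c • X) η x = c • lieDeriv ⇑X η x := by
  have h : fieldInChart ⇑(c • X) x = c • fieldInChart ⇑X x := by
    rw [ContMDiffSection.coe_smul]
    exact VectorField.mpullback_const_smul
  unfold lieDeriv
  rw [h, flatLieDeriv_const_smul]
  rfl

/-- The space `𝔛(M, [μ])` of all smooth vector fields `X` on `M` such that `L_X μ = λ μ` for some
constant `λ ∈ ℝ`. -/
noncomputable def conformalFields (μ : VolumeForm n M) : Submodule ℝ (SmoothVectorField n M) where
  carrier := {X | ∃ c : ℝ, ∀ x : M, lieDeriv X μ.form x = c • μ.form x}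
  add_mem' := by
    rintro X Y ⟨a, ha⟩ ⟨b, hb⟩
    exact ⟨a + b, fun x => by rw [lieDeriv_add, ha, hb, add_smul]⟩
  zero_mem' := by
    refine ⟨0, fun x => ?_⟩
    have h := lieDeriv_smul (0 : ℝ) (0 : SmoothVectorField n M) μ.form x
    rw [zero_smul, zero_smul] at h
    rw [h, zero_smul]
  smul_mem' := by
    rintro c X ⟨a, ha⟩
    exact ⟨c * a, fun x => by rw [lieDeriv_smul, ha, mul_smul]⟩

end Conformal

/-! Write `L_X μ = (div X) μ`. As `μ` vanishes nowhere, the conformal fields are exactly those of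
constant divergence, and codimension can be tested on the functions `div X`. If `X` is
divergence-free, then `div [X, Y] = X(div Y)`.

Suppose `Y ∈ 𝔤` is not conformal. Since `M` is connected, `f = div Y` has nonzero differential
somewhere (`mem_conformalFields_of_fderiv_eq_zero`), hence on a nonempty open set. Choose infinitely
many disjoint open sets `U k` inside it. Because `n > 1`, each carries a divergence-free field `X
k`, supported in `U k`, with `X k (f) ≠ 0` at a chosen point `p k` (`exists_flatDivergence_eq_zero`,
`exists_divergence_bracket_ne_zero`). The brackets `[X k, Y]` lie in `𝔤`, and their divergences live
on disjoint sets. A finite combination with constant divergence has constant `0`, as seen at an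
unused `p j`; evaluating at `p k` then kills each coefficient. So the quotient contains an infinite
independent family.

The rest is the calculus of divergence in coordinates and its independence of the chart. -/

/-! ### Lie derivatives of forms on a normed space. -/

section FlatForms

open Filter Topology

variable {E : Type*} [NormedAddCommGroup E] [NormedSpace ℝ E] {k : ℕ}

/-- The trace is the derivation by which an endomorphism acts on top-degree alternating maps. -/
theorem AlternatingMap.sum_update_eq_trace_mul {R V ι : Type*} [CommRing R] [AddCommGroup V]
    [Module R V] [Fintype ι] [DecidableEq ι] (b : Module.Basis ι R V) (η : V [⋀^ι]→ₗ[R] R)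
    (A : V →ₗ[R] V) :
    ∑ i, η (Function.update b i (A (b i))) = LinearMap.trace R V A * η b := by
  rw [LinearMap.trace_eq_matrix_trace R b, Matrix.trace, Finset.sum_mul]
  refine Finset.sum_congr rfl fun i _ => ?_
  conv_lhs => rw [← b.sum_repr (A (b i)), η.map_update_sum]
  -- An off-diagonal term repeats a basis vector, so alternation kills it.
  rw [Finset.sum_eq_single i]
  · rw [η.map_update_smul, Function.update_eq_self, Matrix.diag_apply, LinearMap.toMatrix_apply,
      smul_eq_mul]
  · intro j _ hj
    rw [η.map_update_smul, η.map_update_self _ hj.symm, smul_zero]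
  · simp

/-- Naturality of the Lie derivative: it commutes with pullback along a map relating the two
vector fields. -/
theorem flatLieDeriv_pullback {φ : E → E} {X X' : E → E} {η η' : E → E [⋀^Fin k]→L[ℝ] ℝ} {y : E}
    (hφ : ContDiffAt ℝ 2 φ y) (hX : DifferentiableAt ℝ X (φ y)) (hX' : DifferentiableAt ℝ X' y)
    (hη : DifferentiableAt ℝ η (φ y)) (hrel : ∀ᶠ z in 𝓝 y, fderiv ℝ φ z (X' z) = X (φ z))
    (hpull : ∀ᶠ z in 𝓝 y, η' z = (η (φ z)).compContinuousLinearMap (fderiv ℝ φ z)) :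
    flatLieDeriv X' η' y =
      (flatLieDeriv X η (φ y)).compContinuousLinearMap (fderiv ℝ φ y) := by
  have hd : DifferentiableAt ℝ φ y := hφ.differentiableAt (by simp)
  have hdd : DifferentiableAt ℝ (fderiv ℝ φ) y :=
    (hφ.fderiv_right (m := 1) (by norm_num)).differentiableAt (by simp)
  have hsymm : IsSymmSndFDerivAt ℝ φ y := hφ.isSymmSndFDerivAt (by simp)
  have h1 : fderiv ℝ η' y = _ := (EventuallyEq.fderiv_eq hpull).trans
    (HasFDerivAt.continuousAlternatingMapCompContinuousLinearMap
      (hη.hasFDerivAt.comp y hd.hasFDerivAt) hdd.hasFDerivAt).fderiv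
  -- The relation `Dφ · X' = X ∘ φ`, differentiated at `y` in two ways.
  have h2 : (fderiv ℝ φ y).comp (fderiv ℝ X' y) + (fderiv ℝ (fderiv ℝ φ) y).flip (X' y) =
      (fderiv ℝ X (φ y)).comp (fderiv ℝ φ y) :=
    (hdd.hasFDerivAt.clm_apply hX'.hasFDerivAt).unique
      ((hX.hasFDerivAt.comp y hd.hasFDerivAt).congr_of_eventuallyEq hrel)
  have h3 (w : E) : fderiv ℝ φ y (fderiv ℝ X' y w) + fderiv ℝ (fderiv ℝ φ) y (X' y) w =
      fderiv ℝ X (φ y) (fderiv ℝ φ y w) := by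
    rw [hsymm (X' y) w]
    exact DFunLike.congr_fun h2 w
  ext v
  have h0 := hpull.self_of_nhds
  rw [flatLieDeriv_apply, h1, h0]
  simp only [ContinuousAlternatingMap.compContinuousLinearMap_apply, flatLieDeriv_apply,
    add_apply, ContinuousLinearMap.comp_apply,
    ContinuousAlternatingMap.add_apply,
    ContinuousAlternatingMap.fderivCompContinuousLinearMap_apply,
    ContinuousAlternatingMap.compContinuousLinearMapCLM_apply, hrel.self_of_nhds]
  rw [add_assoc, ← Finset.sum_add_distrib]
  congr 1
  refine Finset.sum_congr rfl fun i _ => ?_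
  -- In slot `i`, the second-derivative term from the pullback and the `DX'` term add up, by `h3`,
  -- to the `DX` term of the right-hand side.
  have e1 : (fun j => Function.update (fun _ => fderiv ℝ φ y) i
      (fderiv ℝ (fderiv ℝ φ) y (X' y)) j (v j)) =
      Function.update (fderiv ℝ φ y ∘ v) i (fderiv ℝ (fderiv ℝ φ) y (X' y) (v i)) := by
    ext1 j
    by_cases h : j = i
    · subst h; simp
    · simp [Function.update_of_ne h]
  have e2 : (fderiv ℝ φ y ∘ Function.update v i (fderiv ℝ X' y (v i))) =
      Function.update (fderiv ℝ φ y ∘ v) i (fderiv ℝ φ y (fderiv ℝ X' y (v i))) :=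
    Function.comp_update _ _ _ _
  rw [e1, e2, Function.comp_apply, ← ContinuousAlternatingMap.map_update_add, add_comm, h3]
  rfl

end FlatForms

/-! ### Divergence with respect to a density on a normed space. -/

section FlatDivergence

open Filter Topology

variable {E : Type*} [NormedAddCommGroup E] [NormedSpace ℝ E]

/-- The divergence of a vector field with respect to the density `ρ`. -/
noncomputable def flatDivergence (ρ : E → ℝ) (X : E → E) (y : E) : ℝ :=
  fderiv ℝ ρ y (X y) / ρ y + LinearMap.trace ℝ E (fderiv ℝ X y)

/-- The Lie derivative of a top-degree form is the divergence times the form. -/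
theorem flatLieDeriv_eq_flatDivergence_smul {n : ℕ} (b : Module.Basis (Fin n) ℝ E)
    (X : E → E) {η : E → E [⋀^Fin n]→L[ℝ] ℝ} {y : E} (hη : DifferentiableAt ℝ η y)
    (h0 : η y b ≠ 0) :
    flatLieDeriv X η y = flatDivergence (fun z => η z b) X y • η y := by
  have hb : flatLieDeriv X η y b = flatDivergence (fun z => η z b) X y * η y b := by
    have hf : fderiv ℝ (fun z => η z b) y (X y) = fderiv ℝ η y (X y) b := by
      rw [(hη.hasFDerivAt.continuousAlternatingMap_apply_const b).fderiv]
      rfl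
    rw [flatLieDeriv_apply, flatDivergence, add_mul, div_mul_cancel₀ _ h0, hf]
    congr 1
    exact AlternatingMap.sum_update_eq_trace_mul b (η y).toAlternatingMap _
  -- A top-degree form is determined by its value on one basis.
  apply ContinuousAlternatingMap.toAlternatingMap_injective
  rw [AlternatingMap.eq_smul_basis_det b (flatLieDeriv X η y).toAlternatingMap,
    AlternatingMap.eq_smul_basis_det b (flatDivergence (fun z => η z b) X y • η y).toAlternatingMap]
  congr 1

variable [FiniteDimensional ℝ E]

/-- The trace of an endomorphism, as a continuous linear form. -/
noncomputable def traceCLM (E : Type*) [NormedAddCommGroup E] [NormedSpace ℝ E]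
    [FiniteDimensional ℝ E] : (E →L[ℝ] E) →L[ℝ] ℝ :=
  LinearMap.toContinuousLinearMap ((LinearMap.trace ℝ E).comp (ContinuousLinearMap.coeLM ℝ))

theorem traceCLM_apply (A : E →L[ℝ] E) : traceCLM E A = LinearMap.trace ℝ E A := rfl

theorem flatDivergence_contDiffAt {ρ : E → ℝ} {X : E → E} {y : E} {m : WithTop ℕ∞}
    (hρ : ContDiffAt ℝ (m + 1) ρ y) (h0 : ρ y ≠ 0) (hX : ContDiffAt ℝ (m + 1) X y) :
    ContDiffAt ℝ m (flatDivergence ρ X) y := by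
  have hle : m ≤ m + 1 := le_self_add
  refine ContDiffAt.add (((hρ.fderiv_right le_rfl).clm_apply (hX.of_le hle)).div
    (hρ.of_le hle) h0) ?_
  exact (traceCLM E).contDiff.contDiffAt.comp y (hX.fderiv_right le_rfl)

/-- The divergence is a derivation cocycle on vector fields. -/
theorem flatDivergence_lieBracket {ρ : E → ℝ} {X Y : E → E} {y : E}
    (hρ : ContDiffAt ℝ 2 ρ y) (h0 : ρ y ≠ 0) (hX : ContDiffAt ℝ 2 X y) (hY : ContDiffAt ℝ 2 Y y) :
    flatDivergence ρ (VectorField.lieBracket ℝ X Y) y =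
      fderiv ℝ (flatDivergence ρ Y) y (X y) - fderiv ℝ (flatDivergence ρ X) y (Y y) := by
  have hd {Z : E → E} (hZ : ContDiffAt ℝ 2 Z y) : HasFDerivAt Z (fderiv ℝ Z y) y :=
    (hZ.differentiableAt (by simp)).hasFDerivAt
  have hρ' : HasFDerivAt (fderiv ℝ ρ) (fderiv ℝ (fderiv ℝ ρ) y) y :=
    ((hρ.fderiv_right (m := 1) (by norm_num)).differentiableAt (by simp)).hasFDerivAt
  have hdd {Z : E → E} (hZ : ContDiffAt ℝ 2 Z y) : HasFDerivAt (fderiv ℝ Z) (fderiv ℝ (fderiv ℝ Z) y) y :=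
    ((hZ.fderiv_right (m := 1) (by norm_num)).differentiableAt (by simp)).hasFDerivAt
  have key {Z : E → E} (hZ : ContDiffAt ℝ 2 Z y) (w : E) :
      fderiv ℝ (flatDivergence ρ Z) y w =
        (fderiv ℝ (fderiv ℝ ρ) y w (Z y) + fderiv ℝ ρ y (fderiv ℝ Z y w)) / ρ y
        - fderiv ℝ ρ y (Z y) * fderiv ℝ ρ y w / ρ y ^ 2
        + LinearMap.trace ℝ E (fderiv ℝ (fderiv ℝ Z) y w) := by
    have hr : HasFDerivAt ρ (fderiv ℝ ρ y) y := (hρ.differentiableAt (by simp)).hasFDerivAt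
    have h := ((hρ'.clm_apply (hd hZ)).mul ((hasDerivAt_inv h0).comp_hasFDerivAt y hr)).add
      ((traceCLM E).hasFDerivAt.comp y (hdd hZ))
    have h' : fderiv ℝ (flatDivergence ρ Z) y = _ := h.fderiv
    rw [h']
    simp only [add_apply, smul_apply, Function.comp_apply, ContinuousLinearMap.comp_apply,
      ContinuousLinearMap.flip_apply, smul_eq_mul, traceCLM_apply]
    field_simp
    ring
  have hbr := ((hdd hY).clm_apply (hd hX)).sub ((hdd hX).clm_apply (hd hY))
  have hbr' : fderiv ℝ (VectorField.lieBracket ℝ X Y) y = _ := hbr.fderiv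
  have sX : (fderiv ℝ (fderiv ℝ X) y).flip (Y y) = fderiv ℝ (fderiv ℝ X) y (Y y) := by
    ext1 w
    exact hX.isSymmSndFDerivAt (by simp) w (Y y)
  have sY : (fderiv ℝ (fderiv ℝ Y) y).flip (X y) = fderiv ℝ (fderiv ℝ Y) y (X y) := by
    ext1 w
    exact hY.isSymmSndFDerivAt (by simp) w (X y)
  have sρ : fderiv ℝ (fderiv ℝ ρ) y (X y) (Y y) = fderiv ℝ (fderiv ℝ ρ) y (Y y) (X y) :=
    hρ.isSymmSndFDerivAt (by simp) _ _
  -- The first-order part of `D[X, Y]` is a commutator, hence traceless.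
  have htr : traceCLM E ((fderiv ℝ Y y).comp (fderiv ℝ X y)) =
      traceCLM E ((fderiv ℝ X y).comp (fderiv ℝ Y y)) :=
    LinearMap.trace_mul_comm ℝ (fderiv ℝ Y y : E →ₗ[ℝ] E) (fderiv ℝ X y : E →ₗ[ℝ] E)
  rw [key hX, key hY, flatDivergence, hbr', sX, sY, ← traceCLM_apply, ← traceCLM_apply,
    ← traceCLM_apply, map_sub, map_add, map_add, htr, VectorField.lieBracket, map_sub, sρ]
  field_simp
  ring

omit [FiniteDimensional ℝ E] in
theorem flatDivergence_eq_zero_of_eventuallyEq (ρ : E → ℝ) {X : E → E} {y : E}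
    (h : X =ᶠ[𝓝 y] fun _ => 0) : flatDivergence ρ X y = 0 := by
  simp [flatDivergence, h.self_of_nhds, h.fderiv_eq]

/-- The derivative of `ρ⁻¹` cancels the density term, so dividing a trace-free field by `ρ` makes it
divergence-free for `ρ`. -/
theorem flatDivergence_inv_smul {ρ : E → ℝ} {W : E → E} {y : E} (hρ : DifferentiableAt ℝ ρ y)
    (h0 : ρ y ≠ 0) (hW : DifferentiableAt ℝ W y) :
    flatDivergence ρ (fun z => (ρ z)⁻¹ • W z) y = (ρ y)⁻¹ * LinearMap.trace ℝ E (fderiv ℝ W y) := by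
  have h : HasFDerivAt (fun z => (ρ z)⁻¹ • W z) _ y :=
    ((hasDerivAt_inv h0).comp_hasFDerivAt y hρ.hasFDerivAt).smul hW.hasFDerivAt
  have htr : traceCLM E (((-(ρ y ^ 2)⁻¹) • fderiv ℝ ρ y).smulRight (W y)) =
      (-(ρ y ^ 2)⁻¹) * fderiv ℝ ρ y (W y) :=
    LinearMap.trace_smulRight ((-(ρ y ^ 2)⁻¹) • fderiv ℝ ρ y : E →ₗ[ℝ] ℝ) (W y)
  rw [flatDivergence, h.fderiv, ← traceCLM_apply, map_add, htr, map_smul, map_smul, traceCLM_apply]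
  simp only [Function.comp_apply, smul_eq_mul]
  field_simp
  ring

/-- In dimension at least two, a function which is not critical at `p` is not preserved by some
divergence-free vector field supported near `p`. -/
theorem exists_flatDivergence_eq_zero {ρ F : E → ℝ} {U : Set E} {p : E} (hU : IsOpen U)
    (hρ : ContDiffOn ℝ ∞ ρ U) (h0 : ∀ y ∈ U, ρ y ≠ 0) (hp : p ∈ U) (hF : fderiv ℝ F p ≠ 0)
    (hdim : 1 < Module.finrank ℝ E) :
    ∃ Z : E → E, ContDiff ℝ ∞ Z ∧ HasCompactSupport Z ∧ tsupport Z ⊆ U ∧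
      (∀ y, flatDivergence ρ Z y = 0) ∧ fderiv ℝ F p (Z p) ≠ 0 := by
  obtain ⟨χ, hχU, hχc, hχ, -, hχp⟩ := exists_contDiff_tsupport_subset (n := ⊤) (hU.mem_nhds hp)
  obtain ⟨w, hw⟩ : ∃ w, fderiv ℝ F p w ≠ 0 := by
    by_contra! h
    exact hF (ContinuousLinearMap.ext h)
  -- This is where the dimension matters: on a line `dF` would have trivial kernel.
  obtain ⟨u, hu, hu0⟩ := (Submodule.ne_bot_iff _).1
    (LinearMap.ker_ne_bot_of_finrank_lt (f := (fderiv ℝ F p : E →ₗ[ℝ] ℝ)) (by simpa using hdim))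
  replace hu : fderiv ℝ F p u = 0 := hu
  obtain ⟨l, hl⟩ := SeparatingDual.exists_ne_zero (R := ℝ) hu0
  -- A compactly supported potential with differential `l` at `p`, because `χ p = 1` and `l (p - p)
  -- = 0`.
  let g : E → ℝ := fun y => χ y * l (y - p)
  have hg : ContDiff ℝ ∞ g := hχ.mul (l.contDiff.comp (contDiff_id.sub contDiff_const))
  have hgs : tsupport g ⊆ tsupport χ := closure_mono (Function.support_mul_subset_left _ _)
  have hgp : fderiv ℝ g p = l := by
    have h1 : HasFDerivAt χ (fderiv ℝ χ p) p := (hχ.differentiable (by simp) p).hasFDerivAt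
    have h2 : HasFDerivAt (fun y => l (y - p)) l p :=
      l.hasFDerivAt.comp p ((hasFDerivAt_id p).sub_const p)
    have h : fderiv ℝ g p = _ := (h1.mul h2).fderiv
    rw [h, hχp]
    simp
  have hdg : ContDiff ℝ ∞ (fderiv ℝ g) := hg.fderiv_right (by simp)
  -- The Hamiltonian field of `g` in the plane of `u` and `w`; its trace is `D²g(w, u) - D²g(u, w) =
  -- 0`.
  let W : E → E := fun y => fderiv ℝ g y u • w - fderiv ℝ g y w • u
  have hW : ContDiff ℝ ∞ W :=
    ((hdg.clm_apply contDiff_const).smul contDiff_const).sub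
      ((hdg.clm_apply contDiff_const).smul contDiff_const)
  have htr (y : E) : LinearMap.trace ℝ E (fderiv ℝ W y) = 0 := by
    have hd : HasFDerivAt (fderiv ℝ g) (fderiv ℝ (fderiv ℝ g) y) y :=
      (hdg.differentiable (by simp) y).hasFDerivAt
    have hev (v : E) : HasFDerivAt (fun z => fderiv ℝ g z v)
        ((fderiv ℝ (fderiv ℝ g) y).flip v) y := by
      simpa using hd.clm_apply (hasFDerivAt_const v y)
    have h : fderiv ℝ W y = _ := (((hev u).smul_const w).sub ((hev w).smul_const u)).fderiv
    have hs (f : E →L[ℝ] ℝ) (v : E) : traceCLM E (f.smulRight v) = f v :=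
      LinearMap.trace_smulRight (f : E →ₗ[ℝ] ℝ) v
    rw [h, ← traceCLM_apply, map_sub, hs, hs, sub_eq_zero]
    exact (hg.of_le (m := 2) (mod_cast SmoothVectorField.natCast_le_infty 2)).contDiffAt.isSymmSndFDerivAt (by simp) w u
  have hWs : tsupport W ⊆ tsupport χ := by
    refine (closure_minimal (fun y hy => ?_) (isClosed_tsupport (fderiv ℝ g))).trans
      ((tsupport_fderiv_subset ℝ).trans hgs)
    by_contra hy'
    exact hy (by simp [W, image_eq_zero_of_notMem_tsupport hy'])
  let Z : E → E := fun y => (ρ y)⁻¹ • W y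
  have hZs : tsupport Z ⊆ tsupport χ :=
    (closure_mono (Function.support_smul_subset_right _ _)).trans hWs
  -- Smoothness is checked only on the support of `Z`, which lies in `U`, where `ρ` is smooth and
  -- nonzero.
  refine ⟨Z, contMDiff_iff_contDiff.1 <| contMDiff_of_tsupport fun y hy => ?_, hχc.mono' (subset_closure.trans hZs),
    hZs.trans hχU, fun y => ?_, ?_⟩
  · have hyU := hχU (hZs hy)
    exact (((hρ.contDiffAt (hU.mem_nhds hyU)).inv (h0 y hyU)).smul hW.contDiffAt).contMDiffAt
  · by_cases hy : y ∈ U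
    swap
    · exact flatDivergence_eq_zero_of_eventuallyEq ρ
        (notMem_tsupport_iff_eventuallyEq.1 fun h => hy (hχU (hZs h)))
    rw [flatDivergence_inv_smul ((hρ.contDiffAt (hU.mem_nhds hy)).differentiableAt (by simp))
      (h0 y hy) (hW.differentiable (by simp) y), htr, mul_zero]
  -- Since `dF(u) = 0`, the value at `p` is `ρ(p)⁻¹ l(u) dF(w)`.
  · simp only [Z, W, hgp, map_smul, map_sub, hu, smul_eq_mul, mul_zero, sub_zero]
    exact mul_ne_zero (inv_ne_zero (h0 p hp)) (mul_ne_zero hl hw)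

end FlatDivergence

/-! ### Coordinate expressions and independence of the chart. -/

section Charts

open Filter Topology

variable {n : ℕ} {M : Type*} [TopologicalSpace M] [ChartedSpace (EuclideanSpace ℝ (Fin n)) M]
  [IsManifold (𝓡 n) ∞ M]

theorem mfderiv_extChartAt_comp_mfderiv_symm {x₀ : M} {y : EuclideanSpace ℝ (Fin n)}
    (hy : y ∈ (extChartAt (𝓡 n) x₀).target) :
    (mfderiv (𝓡 n) 𝓘(ℝ, EuclideanSpace ℝ (Fin n)) (extChartAt (𝓡 n) x₀)
      ((extChartAt (𝓡 n) x₀).symm y)).comp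
      (mfderiv 𝓘(ℝ, EuclideanSpace ℝ (Fin n)) (𝓡 n) (extChartAt (𝓡 n) x₀).symm y) =
      ContinuousLinearMap.id ℝ _ := by
  have h := mfderiv_extChartAt_comp_mfderivWithin_extChartAt_symm hy
  rw [ModelWithCorners.range_eq_univ, mfderivWithin_univ] at h
  exact h

theorem mfderiv_symm_comp_mfderiv_extChartAt {x₀ : M} {y : EuclideanSpace ℝ (Fin n)}
    (hy : y ∈ (extChartAt (𝓡 n) x₀).target) :
    (mfderiv 𝓘(ℝ, EuclideanSpace ℝ (Fin n)) (𝓡 n) (extChartAt (𝓡 n) x₀).symm y).comp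
      (mfderiv (𝓡 n) 𝓘(ℝ, EuclideanSpace ℝ (Fin n)) (extChartAt (𝓡 n) x₀)
        ((extChartAt (𝓡 n) x₀).symm y)) =
      ContinuousLinearMap.id ℝ _ := by
  have h := mfderivWithin_extChartAt_symm_comp_mfderiv_extChartAt hy
  rw [ModelWithCorners.range_eq_univ, mfderivWithin_univ] at h
  exact h

theorem isInvertible_mfderiv_extChartAt_symm {x₀ : M} {y : EuclideanSpace ℝ (Fin n)}
    (hy : y ∈ (extChartAt (𝓡 n) x₀).target) :
    (mfderiv 𝓘(ℝ, EuclideanSpace ℝ (Fin n)) (𝓡 n) (extChartAt (𝓡 n) x₀).symm y).IsInvertible :=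
  .of_inverse (mfderiv_symm_comp_mfderiv_extChartAt hy) (mfderiv_extChartAt_comp_mfderiv_symm hy)

theorem mfderiv_symm_fieldInChart (X : ∀ x : M, TangentSpace (𝓡 n) x) {x₀ : M}
    {y : EuclideanSpace ℝ (Fin n)} (hy : y ∈ (extChartAt (𝓡 n) x₀).target) :
    mfderiv 𝓘(ℝ, EuclideanSpace ℝ (Fin n)) (𝓡 n) (extChartAt (𝓡 n) x₀).symm y
      (fieldInChart X x₀ y) = X ((extChartAt (𝓡 n) x₀).symm y) :=
  (isInvertible_mfderiv_extChartAt_symm hy).self_apply_inverse _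

theorem fieldInChart_extChartAt (X : ∀ x : M, TangentSpace (𝓡 n) x) {x₀ x : M}
    (hx : x ∈ (extChartAt (𝓡 n) x₀).source) :
    fieldInChart X x₀ (extChartAt (𝓡 n) x₀ x) =
      mfderiv (𝓡 n) 𝓘(ℝ, EuclideanSpace ℝ (Fin n)) (extChartAt (𝓡 n) x₀) x (X x) := by
  have hy := (extChartAt (𝓡 n) x₀).map_source hx
  have h1 : fieldInChart X x₀ (extChartAt (𝓡 n) x₀ x) = _ :=
    (DFunLike.congr_fun (mfderiv_extChartAt_comp_mfderiv_symm hy)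
      (fieldInChart X x₀ (extChartAt (𝓡 n) x₀ x))).symm
  have h2 := mfderiv_symm_fieldInChart X hy
  -- Tangent spaces depend on the base point, so the equality `φ.symm (φ x) = x` is transported
  -- through a generalized point.
  have h3 : ∀ x' : M, x' = x →
      (mfderiv (𝓡 n) 𝓘(ℝ, EuclideanSpace ℝ (Fin n)) (extChartAt (𝓡 n) x₀) x' (X x') :
        EuclideanSpace ℝ (Fin n)) =
      mfderiv (𝓡 n) 𝓘(ℝ, EuclideanSpace ℝ (Fin n)) (extChartAt (𝓡 n) x₀) x (X x) := by
    rintro _ rfl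
    rfl
  exact (h1.trans (congrArg (mfderiv (𝓡 n) 𝓘(ℝ, EuclideanSpace ℝ (Fin n)) (extChartAt (𝓡 n) x₀)
    ((extChartAt (𝓡 n) x₀).symm (extChartAt (𝓡 n) x₀ x))) h2)).trans <| h3 _ ((extChartAt (𝓡 n) x₀).left_inv hx)

theorem formInChart_extChartAt {k : ℕ} (η : ∀ x : M, TangentSpace (𝓡 n) x [⋀^Fin k]→L[ℝ] ℝ)
    {x₀ x : M} (hx : x ∈ (extChartAt (𝓡 n) x₀).source) :
    ContinuousAlternatingMap.compContinuousLinearMap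
      (formInChart η x₀ (extChartAt (𝓡 n) x₀ x))
      (mfderiv (𝓡 n) 𝓘(ℝ, EuclideanSpace ℝ (Fin n)) (extChartAt (𝓡 n) x₀) x) = η x := by
  have hy := (extChartAt (𝓡 n) x₀).map_source hx
  have key : ∀ x' : M, x' = x → ∀ B : TangentSpace (𝓡 n) x →L[ℝ] EuclideanSpace ℝ (Fin n),
      ∀ A : EuclideanSpace ℝ (Fin n) →L[ℝ] TangentSpace (𝓡 n) x',
      (∀ v : EuclideanSpace ℝ (Fin n), A (B v) = v) →
      ((η x').compContinuousLinearMap A).compContinuousLinearMap B = η x := by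
    rintro _ rfl B A hAB
    ext v
    exact congrArg (η _) (funext fun i => hAB (v i))
  refine key _ ((extChartAt (𝓡 n) x₀).left_inv hx) _ _ fun v => ?_
  have h := DFunLike.congr_fun (mfderiv_symm_comp_mfderiv_extChartAt hy) v
  have h3 : ∀ x' : M, x' = x →
      ((mfderiv (𝓡 n) 𝓘(ℝ, EuclideanSpace ℝ (Fin n)) (extChartAt (𝓡 n) x₀) x' :
          EuclideanSpace ℝ (Fin n) →L[ℝ] EuclideanSpace ℝ (Fin n)) v) =
      (mfderiv (𝓡 n) 𝓘(ℝ, EuclideanSpace ℝ (Fin n)) (extChartAt (𝓡 n) x₀) x :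
          EuclideanSpace ℝ (Fin n) →L[ℝ] EuclideanSpace ℝ (Fin n)) v := by
    rintro _ rfl
    rfl
  refine Eq.trans (congrArg _ (h3 _ ((extChartAt (𝓡 n) x₀).left_inv hx)).symm) h

theorem SmoothVectorField.contDiffOn_fieldInChart (X : SmoothVectorField n M) (x₀ : M) :
    ContDiffOn ℝ ∞ (fieldInChart X x₀) (extChartAt (𝓡 n) x₀).target := by
  intro y hy
  have hs : ContMDiffAt 𝓘(ℝ, EuclideanSpace ℝ (Fin n)) (𝓡 n) ∞ (extChartAt (𝓡 n) x₀).symm y :=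
    (contMDiffOn_extChartAt_symm x₀).contMDiffAt ((isOpen_extChartAt_target x₀).mem_nhds hy)
  exact (contMDiffAt_vectorSpace_iff_contDiffAt.1 (ContMDiffAt.mpullback_vectorField_preimage
    X.contMDiff.contMDiffAt hs (isInvertible_mfderiv_extChartAt_symm hy) le_rfl)).contDiffWithinAt

theorem SmoothVectorField.fieldInChart_bracket (X Y : SmoothVectorField n M) {x₀ : M}
    {y : EuclideanSpace ℝ (Fin n)} (hy : y ∈ (extChartAt (𝓡 n) x₀).target) :
    fieldInChart ⇑⁅X, Y⁆ x₀ y =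
      VectorField.lieBracket ℝ (fieldInChart X x₀) (fieldInChart Y x₀) y := by
  have := isManifold_of_infty n M 2
  have hs : ContMDiffAt 𝓘(ℝ, EuclideanSpace ℝ (Fin n)) (𝓡 n) ∞ (extChartAt (𝓡 n) x₀).symm y :=
    (contMDiffOn_extChartAt_symm x₀).contMDiffAt ((isOpen_extChartAt_target x₀).mem_nhds hy)
  have : IsManifold (𝓡 n) (minSmoothness ℝ 3) M := by
    simpa using isManifold_of_infty n M 3
  refine (VectorField.mpullback_mlieBracket (X.mdiffAt _) (Y.mdiffAt _) hs
    (by simpa using natCast_le_infty 2)).trans ?_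
  rw [← VectorField.mlieBracketWithin_univ, VectorField.mlieBracketWithin_eq_lieBracketWithin]
  exact congrFun VectorField.lieBracketWithin_univ y

/-- The Lie derivative can be computed in any chart. -/
theorem lieDeriv_eq_of_mem_source {k : ℕ} (X : SmoothVectorField n M)
    {η : ∀ x : M, TangentSpace (𝓡 n) x [⋀^Fin k]→L[ℝ] ℝ} {x₀ x : M}
    (hη : ContDiffOn ℝ ∞ (formInChart η x₀) (extChartAt (𝓡 n) x₀).target)
    (hx : x ∈ (extChartAt (𝓡 n) x₀).source) :
    lieDeriv X η x = ContinuousAlternatingMap.compContinuousLinearMap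
      (flatLieDeriv (fieldInChart X x₀) (formInChart η x₀) (extChartAt (𝓡 n) x₀ x))
      (mfderiv (𝓡 n) 𝓘(ℝ, EuclideanSpace ℝ (Fin n)) (extChartAt (𝓡 n) x₀) x) := by
  have := SmoothVectorField.isManifold_of_infty n M 2
  let φ₀ := extChartAt (𝓡 n) x₀
  let φ := extChartAt (𝓡 n) x
  have hxs : x ∈ φ.source := mem_extChartAt_source x
  have hy : φ x ∈ φ.target := φ.map_source hxs
  have hxx : φ.symm (φ x) = x := φ.left_inv hxs
  -- The transition map relates the two coordinate expressions of `X` and pulls one expression of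
  -- `η` back to the other, so `flatLieDeriv_pullback` applies.
  let τ : EuclideanSpace ℝ (Fin n) → EuclideanSpace ℝ (Fin n) := fun z => φ₀ (φ.symm z)
  have hmem : ∀ᶠ z in 𝓝 (φ x), z ∈ φ.target ∧ φ.symm z ∈ φ₀.source := by
    refine ((isOpen_extChartAt_target x).eventually_mem hy).and ?_
    refine (continuousAt_extChartAt_symm x).eventually_mem ?_
    exact (isOpen_extChartAt_source x₀).mem_nhds (by rwa [extChartAt_to_inv])
  have hsymm {z : EuclideanSpace ℝ (Fin n)} (hz : z ∈ φ.target) :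
      ContMDiffAt 𝓘(ℝ, EuclideanSpace ℝ (Fin n)) (𝓡 n) ∞ φ.symm z :=
    (contMDiffOn_extChartAt_symm x).contMDiffAt ((isOpen_extChartAt_target x).mem_nhds hz)
  have hφ₀ {p : M} (hp : p ∈ φ₀.source) :
      ContMDiffAt (𝓡 n) 𝓘(ℝ, EuclideanSpace ℝ (Fin n)) ∞ φ₀ p :=
    contMDiffAt_extChartAt' (by rwa [extChartAt_source] at hp)
  have hτ {z : EuclideanSpace ℝ (Fin n)} (hz : z ∈ φ.target ∧ φ.symm z ∈ φ₀.source) :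
      ContDiffAt ℝ ∞ τ z :=
    contMDiffAt_iff_contDiffAt.1 ((hφ₀ hz.2).comp z (hsymm hz.1))
  have hdτ {z : EuclideanSpace ℝ (Fin n)} (hz : z ∈ φ.target ∧ φ.symm z ∈ φ₀.source) :
      fderiv ℝ τ z = (mfderiv (𝓡 n) 𝓘(ℝ, EuclideanSpace ℝ (Fin n)) φ₀ (φ.symm z)).comp
        (mfderiv 𝓘(ℝ, EuclideanSpace ℝ (Fin n)) (𝓡 n) φ.symm z) := by
    rw [← mfderiv_eq_fderiv]
    exact mfderiv_comp z ((hφ₀ hz.2).mdifferentiableAt (by simp))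
      ((hsymm hz.1).mdifferentiableAt (by simp))
  have hτx : τ (φ x) = φ₀ x := congrArg φ₀ hxx
  have hφx : φ₀ x ∈ φ₀.target := φ₀.map_source hx
  have key := flatLieDeriv_pullback (X := fieldInChart X x₀) (X' := fieldInChart X x)
    (η := formInChart η x₀) (η' := formInChart η x)
    ((hτ hmem.self_of_nhds).of_le (mod_cast SmoothVectorField.natCast_le_infty 2))
    (by
      rw [hτx]
      exact ((X.contDiffOn_fieldInChart x₀).contDiffAt
        ((isOpen_extChartAt_target x₀).mem_nhds hφx)).differentiableAt (by simp))
    (X.differentiableAt_fieldInChart x)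
    (by
      rw [hτx]
      exact (hη.contDiffAt ((isOpen_extChartAt_target x₀).mem_nhds hφx)).differentiableAt (by simp))
    (hmem.mono fun z hz => by
      rw [hdτ hz]
      exact (congrArg _ (mfderiv_symm_fieldInChart X hz.1)).trans
        (fieldInChart_extChartAt X hz.2).symm)
    (hmem.mono fun z hz => by
      rw [hdτ hz]
      exact congrArg (fun θ : TangentSpace (𝓡 n) (φ.symm z) [⋀^Fin k]→L[ℝ] ℝ =>
        θ.compContinuousLinearMap (mfderiv 𝓘(ℝ, EuclideanSpace ℝ (Fin n)) (𝓡 n) φ.symm z))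
        (formInChart_extChartAt η hz.2).symm)
  have hcomp : mfderiv (𝓡 n) 𝓘(ℝ, EuclideanSpace ℝ (Fin n)) φ₀ x =
      (fderiv ℝ τ (φ x)).comp (mfderiv (𝓡 n) 𝓘(ℝ, EuclideanSpace ℝ (Fin n)) φ x) := by
    have h1 : φ₀ =ᶠ[𝓝 x] τ ∘ φ := by
      filter_upwards [(isOpen_extChartAt_source x).mem_nhds hxs] with p hp
      exact (congrArg φ₀ (φ.left_inv hp)).symm
    rw [h1.mfderiv_eq, ← mfderiv_eq_fderiv]
    exact mfderiv_comp x
      ((contMDiffAt_iff_contDiffAt.2 (hτ hmem.self_of_nhds)).mdifferentiableAt (by simp))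
      (mdifferentiableAt_extChartAt (mem_chart_source _ x))
  rw [lieDeriv, key, hτx]
  change _ = ContinuousAlternatingMap.compContinuousLinearMap _
    (mfderiv (𝓡 n) 𝓘(ℝ, EuclideanSpace ℝ (Fin n)) φ₀ x)
  rw [hcomp]
  rfl

end Charts

/-! ### Divergence on a manifold with a volume form. -/

section Divergence

open Filter Topology

variable {n : ℕ} {M : Type*} [TopologicalSpace M] [ChartedSpace (EuclideanSpace ℝ (Fin n)) M]
  [IsManifold (𝓡 n) ∞ M]

namespace VolumeForm

/-- The density of a volume form with respect to Lebesgue measure in the chart at `x₀`. -/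
noncomputable def density (μ : VolumeForm n M) (x₀ : M) (y : EuclideanSpace ℝ (Fin n)) : ℝ :=
  formInChart μ.form x₀ y (EuclideanSpace.basisFun (Fin n) ℝ).toBasis

omit [IsManifold (𝓡 n) ∞ M] in
theorem contDiffOn_density (μ : VolumeForm n M) (x₀ : M) :
    ContDiffOn ℝ ∞ (μ.density x₀) (extChartAt (𝓡 n) x₀).target := fun y hy =>
  (ContinuousAlternatingMap.apply ℝ (EuclideanSpace ℝ (Fin n)) ℝ
    (⇑(EuclideanSpace.basisFun (Fin n) ℝ).toBasis)).contDiff.contDiffAt.comp_contDiffWithinAt y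
    (μ.smooth x₀ y hy)

theorem density_ne_zero (μ : VolumeForm n M) {x₀ : M} {y : EuclideanSpace ℝ (Fin n)}
    (hy : y ∈ (extChartAt (𝓡 n) x₀).target) : μ.density x₀ y ≠ 0 := by
  intro h
  have h0 : formInChart μ.form x₀ y = 0 := ContinuousAlternatingMap.toAlternatingMap_injective
    ((AlternatingMap.map_basis_eq_zero_iff _ (formInChart μ.form x₀ y).toAlternatingMap).1 h)
  have h1 := formInChart_extChartAt μ.form ((extChartAt (𝓡 n) x₀).map_target hy)
  rw [(extChartAt (𝓡 n) x₀).right_inv hy, h0] at h1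
  exact μ.ne_zero _ h1.symm

/-- The divergence of a vector field with respect to a volume form. -/
noncomputable def divergence (μ : VolumeForm n M) (X : SmoothVectorField n M) (x : M) : ℝ :=
  flatDivergence (μ.density x) (fieldInChart X x) (extChartAt (𝓡 n) x x)

theorem lieDeriv_eq_flatDivergence_smul (μ : VolumeForm n M) (X : SmoothVectorField n M) {x₀ x : M}
    (hx : x ∈ (extChartAt (𝓡 n) x₀).source) :
    lieDeriv X μ.form x =
      flatDivergence (μ.density x₀) (fieldInChart X x₀) (extChartAt (𝓡 n) x₀ x) • μ.form x := by
  have hy := (extChartAt (𝓡 n) x₀).map_source hx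
  rw [lieDeriv_eq_of_mem_source X (μ.smooth x₀) hx, flatLieDeriv_eq_flatDivergence_smul
    (EuclideanSpace.basisFun (Fin n) ℝ).toBasis _
    (((μ.smooth x₀).contDiffAt ((isOpen_extChartAt_target x₀).mem_nhds hy)).differentiableAt
      (by simp)) (μ.density_ne_zero hy)]
  exact congrArg (flatDivergence (μ.density x₀) (fieldInChart X x₀) (extChartAt (𝓡 n) x₀ x) • ·)
    (formInChart_extChartAt μ.form hx)

theorem lieDeriv_eq_divergence_smul (μ : VolumeForm n M) (X : SmoothVectorField n M) (x : M) :
    lieDeriv X μ.form x = μ.divergence X x • μ.form x :=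
  μ.lieDeriv_eq_flatDivergence_smul X (mem_extChartAt_source x)

/-- The divergence can be computed in any chart. -/
theorem divergence_eq_of_mem_source (μ : VolumeForm n M) (X : SmoothVectorField n M) {x₀ x : M}
    (hx : x ∈ (extChartAt (𝓡 n) x₀).source) :
    μ.divergence X x =
      flatDivergence (μ.density x₀) (fieldInChart X x₀) (extChartAt (𝓡 n) x₀ x) :=
  smul_left_injective ℝ (μ.ne_zero x)
    ((μ.lieDeriv_eq_divergence_smul X x).symm.trans (μ.lieDeriv_eq_flatDivergence_smul X hx))

/-- The divergence as a linear map. -/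
noncomputable def divergenceₗ (μ : VolumeForm n M) : SmoothVectorField n M →ₗ[ℝ] M → ℝ where
  toFun := μ.divergence
  map_add' X Y := funext fun x => smul_left_injective ℝ (μ.ne_zero x) <| by
    simp only [Pi.add_apply, add_smul, ← lieDeriv_eq_divergence_smul, lieDeriv_add]
  map_smul' c X := funext fun x => smul_left_injective ℝ (μ.ne_zero x) <| by
    simp only [Pi.smul_apply, RingHom.id_apply, smul_assoc, ← lieDeriv_eq_divergence_smul,
      lieDeriv_smul]

theorem divergenceₗ_apply (μ : VolumeForm n M) (X : SmoothVectorField n M) (x : M) :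
    μ.divergenceₗ X x = μ.divergence X x := rfl

/-- A nowhere vanishing form determines its scalar factor pointwise; membership thus becomes a
condition on a single function. -/
theorem mem_conformalFields_iff (μ : VolumeForm n M) (X : SmoothVectorField n M) :
    X ∈ conformalFields μ ↔ ∃ c : ℝ, ∀ x, μ.divergence X x = c := by
  refine exists_congr fun c => forall_congr' fun x => ?_
  rw [lieDeriv_eq_divergence_smul, (smul_left_injective ℝ (μ.ne_zero x)).eq_iff]

theorem contDiffOn_flatDivergence (μ : VolumeForm n M) (X : SmoothVectorField n M) (x₀ : M) :
    ContDiffOn ℝ ∞ (flatDivergence (μ.density x₀) (fieldInChart X x₀))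
      (extChartAt (𝓡 n) x₀).target := fun y hy => by
  have ho := (isOpen_extChartAt_target (I := 𝓡 n) x₀).mem_nhds hy
  exact (flatDivergence_contDiffAt (m := ∞) ((μ.contDiffOn_density x₀).contDiffAt ho)
    (μ.density_ne_zero hy) ((X.contDiffOn_fieldInChart x₀).contDiffAt ho)).contDiffWithinAt

/-- The bracket with a divergence-free field `X` acts on divergences as the derivative along `X`. -/
theorem divergence_bracket_of_divergence_eq_zero (μ : VolumeForm n M)
    {X : SmoothVectorField n M} (hX : ∀ x, μ.divergence X x = 0) (Y : SmoothVectorField n M)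
    {x₀ x : M} (hx : x ∈ (extChartAt (𝓡 n) x₀).source) :
    μ.divergence ⁅X, Y⁆ x = fderiv ℝ (flatDivergence (μ.density x₀) (fieldInChart Y x₀))
      (extChartAt (𝓡 n) x₀ x) (fieldInChart X x₀ (extChartAt (𝓡 n) x₀ x)) := by
  have hy := (extChartAt (𝓡 n) x₀).map_source hx
  have ho := (isOpen_extChartAt_target (I := 𝓡 n) x₀).mem_nhds hy
  have hle : (2 : WithTop ℕ∞) ≤ ∞ := mod_cast SmoothVectorField.natCast_le_infty 2
  have h1 : fieldInChart ⇑⁅X, Y⁆ x₀ =ᶠ[𝓝 (extChartAt (𝓡 n) x₀ x)]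
      VectorField.lieBracket ℝ (fieldInChart X x₀) (fieldInChart Y x₀) :=
    mem_of_superset ho fun z hz => X.fieldInChart_bracket Y hz
  -- The divergence of `X` vanishes on the whole chart, so its derivative drops out of the cocycle
  -- identity.
  have h2 : flatDivergence (μ.density x₀) (fieldInChart X x₀) =ᶠ[𝓝 (extChartAt (𝓡 n) x₀ x)]
      fun _ => 0 := mem_of_superset ho fun z hz => by
    have h := μ.divergence_eq_of_mem_source X ((extChartAt (𝓡 n) x₀).map_target hz)
    rw [hX, (extChartAt (𝓡 n) x₀).right_inv hz] at h
    exact h.symm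
  have h3 := flatDivergence_lieBracket (((μ.contDiffOn_density x₀).contDiffAt ho).of_le hle)
    (μ.density_ne_zero hy) (((X.contDiffOn_fieldInChart x₀).contDiffAt ho).of_le hle)
    (((Y.contDiffOn_fieldInChart x₀).contDiffAt ho).of_le hle)
  rw [h2.fderiv_eq, fderiv_const_apply, zero_apply, sub_zero] at h3
  rw [μ.divergence_eq_of_mem_source _ hx, ← h3, flatDivergence, flatDivergence, h1.fderiv_eq,
    h1.self_of_nhds]

end VolumeForm

/-- Extension by zero of a compactly supported vector field given in a chart. -/
theorem SmoothVectorField.exists_fieldInChart_eq [T2Space M] {x₀ : M}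
    {Z : EuclideanSpace ℝ (Fin n) → EuclideanSpace ℝ (Fin n)} (hZ : ContDiff ℝ ∞ Z)
    (hc : HasCompactSupport Z) (hs : tsupport Z ⊆ (extChartAt (𝓡 n) x₀).target) :
    ∃ X : SmoothVectorField n M,
      (∀ y ∈ (extChartAt (𝓡 n) x₀).target, fieldInChart X x₀ y = Z y) ∧
      ∀ x ∉ (extChartAt (𝓡 n) x₀).source, ∀ᶠ x' in 𝓝 x, X x' = 0 := by
  classical
  have : IsManifold (𝓡 n) (∞ + 1) M := by
    change IsManifold (𝓡 n) ∞ M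
    infer_instance
  let φ := extChartAt (𝓡 n) x₀
  let V : ∀ x : M, TangentSpace (𝓡 n) x :=
    VectorField.mpullback (𝓡 n) 𝓘(ℝ, EuclideanSpace ℝ (Fin n)) φ Z
  let X : ∀ x : M, TangentSpace (𝓡 n) x := fun x => if x ∈ φ.source then V x else 0
  -- A compact set is closed because `M` is Hausdorff; hence the chart domain and the complement of
  -- this set form an open cover on which smoothness can be glued.
  have hK : IsClosed (φ.symm '' tsupport Z) :=
    (hc.isCompact.image_of_continuousOn ((continuousOn_extChartAt_symm x₀).mono hs)).isClosed
  have hX0 : ∀ x ∈ (φ.symm '' tsupport Z)ᶜ, X x = 0 := by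
    intro x hx
    by_cases hxs : x ∈ φ.source
    · have : Z (φ x) = 0 := image_eq_zero_of_notMem_tsupport fun h => hx ⟨φ x, h, φ.left_inv hxs⟩
      simp only [X, if_pos hxs, V]
      exact (congrArg _ this).trans (map_zero _)
    · simp only [X, if_neg hxs]
  have hXs : ContMDiffOn (𝓡 n) ((𝓡 n).prod 𝓘(ℝ, EuclideanSpace ℝ (Fin n))) ∞
      (fun x => (⟨x, X x⟩ : TangentBundle (𝓡 n) M)) φ.source := by
    have hV : ContMDiffOn (𝓡 n) ((𝓡 n).prod 𝓘(ℝ, EuclideanSpace ℝ (Fin n))) ∞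
        (fun x => (⟨x, V x⟩ : TangentBundle (𝓡 n) M)) φ.source := fun x hx =>
      (ContMDiffAt.mpullback_vectorField_preimage
        (contMDiffAt_vectorSpace_iff_contDiffAt.2 hZ.contDiffAt)
        (contMDiffAt_extChartAt' (by rwa [extChartAt_source] at hx))
        (isInvertible_mfderiv_extChartAt hx) le_rfl).contMDiffWithinAt
    exact hV.congr fun x hx => by simp only [X, if_pos hx]
  have hX : ContMDiff (𝓡 n) ((𝓡 n).prod 𝓘(ℝ, EuclideanSpace ℝ (Fin n))) ∞
      (fun x => (⟨x, X x⟩ : TangentBundle (𝓡 n) M)) := by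
    refine contMDiff_of_contMDiffOn_union_of_isOpen hXs
      (((Bundle.contMDiff_zeroSection ℝ (TangentSpace (𝓡 n) : M → Type _)).contMDiffOn).congr
        fun x hx => ?_) (Set.eq_univ_of_forall fun x => ?_) (isOpen_extChartAt_source x₀)
        hK.isOpen_compl
    · rw [hX0 x hx]
      rfl
    · by_cases hx : x ∈ φ.source
      · exact Or.inl hx
      · refine Or.inr fun ⟨y, hy, hyx⟩ => hx (hyx ▸ φ.map_target (hs hy))
  refine ⟨⟨X, hX⟩, fun y hy => ?_, fun x hx => ?_⟩
  · have hsrc := φ.map_target hy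
    have h := fieldInChart_extChartAt X hsrc
    have hXV : X (φ.symm y) = V (φ.symm y) := if_pos hsrc
    have hy' : φ (φ.symm y) = y := φ.right_inv hy
    rw [hXV] at h
    have h2 := h.trans ((isInvertible_mfderiv_extChartAt hsrc).self_apply_inverse _)
    change fieldInChart X x₀ (φ (φ.symm y)) = Z (φ (φ.symm y)) at h2
    rwa [hy'] at h2
  · refine mem_of_superset (hK.isOpen_compl.mem_nhds ?_) hX0
    rintro ⟨y, hy, rfl⟩
    exact hx (φ.map_target (hs hy))

end Divergence

/-! ### Localized divergence-free perturbations and the codimension argument. -/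

section Codimension

open Filter Topology

variable {n : ℕ} {M : Type*} [TopologicalSpace M] [ChartedSpace (EuclideanSpace ℝ (Fin n)) M]
  [IsManifold (𝓡 n) ∞ M]

namespace VolumeForm

/-- Near a point where the divergence of `Y` is not critical, some divergence-free field `X`
supported nearby does not preserve the divergence of `Y`. -/
theorem exists_divergence_bracket_ne_zero [T2Space M] (hn : 1 < n) (μ : VolumeForm n M)
    (Y : SmoothVectorField n M) {x₀ : M} {U : Set (EuclideanSpace ℝ (Fin n))} (hU : IsOpen U)
    (hUt : U ⊆ (extChartAt (𝓡 n) x₀).target) {p : EuclideanSpace ℝ (Fin n)} (hp : p ∈ U)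
    (hY : fderiv ℝ (flatDivergence (μ.density x₀) (fieldInChart Y x₀)) p ≠ 0) :
    ∃ X : SmoothVectorField n M, (∀ x, μ.divergence X x = 0) ∧
      (∀ x, μ.divergence ⁅X, Y⁆ x ≠ 0 →
        x ∈ (extChartAt (𝓡 n) x₀).source ∧ extChartAt (𝓡 n) x₀ x ∈ U) ∧
      μ.divergence ⁅X, Y⁆ ((extChartAt (𝓡 n) x₀).symm p) ≠ 0 := by
  obtain ⟨Z, hZ, hc, hs, hdiv, hne⟩ := exists_flatDivergence_eq_zero hU
    ((μ.contDiffOn_density x₀).mono hUt) (fun y hy => μ.density_ne_zero (hUt hy)) hp hY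
    (by simpa using hn)
  obtain ⟨X, hX, hX0⟩ := SmoothVectorField.exists_fieldInChart_eq hZ hc (hs.trans hUt)
  have hdivX : ∀ x, μ.divergence X x = 0 := by
    intro x
    by_cases hx : x ∈ (extChartAt (𝓡 n) x₀).source
    · have hev : fieldInChart X x₀ =ᶠ[𝓝 (extChartAt (𝓡 n) x₀ x)] Z := mem_of_superset
        ((isOpen_extChartAt_target x₀).mem_nhds ((extChartAt (𝓡 n) x₀).map_source hx)) hX
      rw [μ.divergence_eq_of_mem_source X hx, ← hdiv (extChartAt (𝓡 n) x₀ x), flatDivergence,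
        flatDivergence, hev.fderiv_eq, hev.self_of_nhds]
    -- Outside the chart domain of `x₀`, `X` vanishes near `x`, hence so does its expression in the
    -- chart at `x`.
    · refine flatDivergence_eq_zero_of_eventuallyEq _ ?_
      have h := (continuousAt_extChartAt_symm (I := 𝓡 n) x).eventually
        (by simpa only [extChartAt_to_inv] using hX0 x hx)
      exact h.mono fun z hz => (congrArg _ hz).trans (map_zero _)
  refine ⟨X, hdivX, fun x => ?_, ?_⟩
  · contrapose!
    intro hx
    by_cases hxs : x ∈ (extChartAt (𝓡 n) x₀).source
    · rw [μ.divergence_bracket_of_divergence_eq_zero hdivX Y hxs,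
        hX _ ((extChartAt (𝓡 n) x₀).map_source hxs),
        image_eq_zero_of_notMem_tsupport fun h => hx hxs (hs h), map_zero]
    · rw [μ.divergence_bracket_of_divergence_eq_zero hdivX Y (mem_extChartAt_source x),
        fieldInChart_extChartAt _ (mem_extChartAt_source x), (hX0 x hxs).self_of_nhds]
      exact (congrArg _ (map_zero _)).trans (map_zero _)
  · rw [μ.divergence_bracket_of_divergence_eq_zero hdivX Y
      ((extChartAt (𝓡 n) x₀).map_target (hUt hp)), (extChartAt (𝓡 n) x₀).right_inv (hUt hp),
      hX p (hUt hp)]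
    exact hne

/-- A field whose divergence has no regular point is conformal. -/
theorem mem_conformalFields_of_fderiv_eq_zero [ConnectedSpace M] (μ : VolumeForm n M)
    (Y : SmoothVectorField n M)
    (h : ∀ x₀ : M, ∀ y ∈ (extChartAt (𝓡 n) x₀).target,
      fderiv ℝ (flatDivergence (μ.density x₀) (fieldInChart Y x₀)) y = 0) :
    Y ∈ conformalFields μ := by
  have hloc : IsLocallyConstant (μ.divergence Y) := by
    refine (IsLocallyConstant.iff_eventually_eq _).2 fun x => ?_
    obtain ⟨r, hr, hball⟩ := Metric.mem_nhds_iff.1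
      ((isOpen_extChartAt_target (I := 𝓡 n) x).mem_nhds (mem_extChartAt_target x))
    filter_upwards [(continuousAt_extChartAt (I := 𝓡 n) x).preimage_mem_nhds
      (Metric.ball_mem_nhds _ hr), (isOpen_extChartAt_source (I := 𝓡 n) x).mem_nhds
      (mem_extChartAt_source x)] with x' hx' hxs
    rw [μ.divergence_eq_of_mem_source Y hxs,
      μ.divergence_eq_of_mem_source Y (mem_extChartAt_source x)]
    -- A ball in the chart is connected, so a vanishing derivative forces constancy there.
    exact Metric.isOpen_ball.is_const_of_fderiv_eq_zero (convex_ball _ _).isPreconnected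
      (((μ.contDiffOn_flatDivergence Y x).mono hball).differentiableOn (by simp))
      (fun y hy => h x y (hball hy)) hx' (Metric.mem_ball_self hr)
  obtain ⟨x₁⟩ := (inferInstance : Nonempty M)
  exact (μ.mem_conformalFields_iff Y).2
    ⟨μ.divergence Y x₁, fun x => hloc.apply_eq_of_preconnectedSpace x x₁⟩

end VolumeForm

end Codimension

theorem mainTheorem7 {n : ℕ} (hn : 1 < n)
    (M : Type*) [TopologicalSpace M] [T2Space M] [ConnectedSpace M]
    [ChartedSpace (EuclideanSpace ℝ (Fin n)) M] [IsManifold (𝓡 n) ∞ M]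
    (μ : VolumeForm n M) :
    ¬ ∃ 𝔤 : LieSubalgebra ℝ (SmoothVectorField n M),
      conformalFields μ < 𝔤.toSubmodule ∧
      FiniteDimensional ℝ
        (𝔤.toSubmodule ⧸ (conformalFields μ).submoduleOf 𝔤.toSubmodule) := by
  rintro ⟨𝔤, hlt, hfin⟩
  obtain ⟨Y, hY𝔤, hY⟩ := SetLike.exists_of_lt hlt
  obtain ⟨x₀, y₀, hy₀, hd⟩ : ∃ x₀ : M, ∃ y ∈ (extChartAt (𝓡 n) x₀).target,
      fderiv ℝ (flatDivergence (μ.density x₀) (fieldInChart Y x₀)) y ≠ 0 := by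
    by_contra! h
    exact hY (μ.mem_conformalFields_of_fderiv_eq_zero Y h)
  let φ := extChartAt (𝓡 n) x₀
  let O := {y ∈ φ.target | fderiv ℝ (flatDivergence (μ.density x₀) (fieldInChart Y x₀)) y ≠ 0}
  have hφt : IsOpen φ.target := isOpen_extChartAt_target x₀
  have hO : IsOpen O := ((μ.contDiffOn_flatDivergence Y x₀).continuousOn_fderiv_of_isOpen hφt
    (by simp)).isOpen_inter_preimage hφt isOpen_compl_singleton
  have : Nontrivial (EuclideanSpace ℝ (Fin n)) :=
    Module.nontrivial_of_finrank_pos (R := ℝ) (by simpa using hn.pos)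
  have : Infinite O := (infinite_of_mem_nhds y₀ (hO.mem_nhds ⟨hy₀, hd⟩)).to_subtype
  -- Every infinite Hausdorff space contains such a sequence; here the space is `O` itself, so the
  -- `U k` are pushed forward to the model space below.
  obtain ⟨U, hUinf, hUo, hUd⟩ := exists_seq_infinite_isOpen_pairwise_disjoint O
  choose p hp using fun k => (hUinf k).nonempty
  choose X hX0 hXs hXp using fun k => μ.exists_divergence_bracket_ne_zero hn Y (x₀ := x₀)
    (hO.isOpenMap_subtype_val _ (hUo k))
    (Set.image_subset_iff.2 fun y _ => y.2.1) (Set.mem_image_of_mem _ (hp k)) (p k).2.2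
  have hoff {j k : ℕ} (hjk : k ≠ j) : μ.divergence ⁅X k, Y⁆ (φ.symm (p j)) = 0 := by
    by_contra h
    obtain ⟨-, y, hy, hyp⟩ := hXs k _ h
    rw [φ.right_inv (p j).2.1] at hyp
    exact Set.disjoint_left.1 (hUd hjk) hy (Subtype.ext hyp ▸ hp j)
  -- `X k` is conformal with constant `0`, so it lies in `𝔤`, which is closed under brackets.
  have hX𝔤 (k : ℕ) : ⁅X k, Y⁆ ∈ 𝔤.toSubmodule :=
    𝔤.lie_mem (hlt.le ((μ.mem_conformalFields_iff _).2 ⟨0, hX0 k⟩)) hY𝔤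
  let Z : ℕ → 𝔤.toSubmodule := fun k => ⟨⁅X k, Y⁆, hX𝔤 k⟩
  have hli : LinearIndependent ℝ
      fun k => ((conformalFields μ).submoduleOf 𝔤.toSubmodule).mkQ (Z k) := by
    rw [linearIndependent_iff']
    intro s c hc k hk
    simp_rw [← map_smul, ← map_sum] at hc
    have hmem : ∑ k ∈ s, c k • ⁅X k, Y⁆ ∈ conformalFields μ := by
      have h : ((∑ k ∈ s, c k • Z k : 𝔤.toSubmodule) : SmoothVectorField n M) ∈
        conformalFields μ :=
        (Submodule.Quotient.mk_eq_zero ((conformalFields μ).submoduleOf 𝔤.toSubmodule)).1 hc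
      simpa [Z] using h
    obtain ⟨a, ha⟩ := (μ.mem_conformalFields_iff _).1 hmem
    have hsum (j : ℕ) : ∑ k ∈ s, c k * μ.divergence ⁅X k, Y⁆ (φ.symm (p j)) = a := by
      rw [← ha (φ.symm (p j)), ← μ.divergenceₗ_apply, map_sum, Finset.sum_apply]
      exact Finset.sum_congr rfl fun k _ => by rw [map_smul]; rfl
    -- At `p j` with `j ∉ s` every summand vanishes, so the constant `a` is `0`.
    obtain ⟨j, hj⟩ := Infinite.exists_notMem_finset s
    have ha0 : a = 0 := by
      rw [← hsum j]
      exact Finset.sum_eq_zero fun k hk => by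
        rw [hoff (ne_of_mem_of_not_mem hk hj), mul_zero]
    have h := hsum k
    -- At `p k` only the `k`-th divergence survives, and it is nonzero there.
    rw [Finset.sum_eq_single_of_mem k hk fun i _ hi => by rw [hoff hi, mul_zero], ha0] at h
    exact (mul_eq_zero.1 h).resolve_right (hXp k)
  have := hli.finite
  exact not_finite ℕ
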